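/- **Proposition 1 (advantage of the fewer).** Let $M$ be an odd number of outlets, $\tfrac12<p<1$, $\tfrac12<\mu\le 1$, $0<\gamma<1$ and $\alpha\ge 0$ (the basic model is $\alpha=1$). The state of the world is $\omega\in\{0,1\}$, outlet $m$ carries a fixed signal $y_m\in\{0,1\}$, and $y_K$ is the signal carried by the majority of outlets. Individual $n=1,2,\dots$ has private signals $(x_n,z_n)\in\{0,1\}^2$. Given $(\omega,(y_m)_m)$, one has $x_n=\omega$ with probability $p$ and $z_n=y_K$ with probability $\mu$, all these signals being independent. Let $[m]$ be the number of outlets carrying the same signal as $m$, and let $v^*_{n,m}$ equal $1/[m]$ if $x_n=y_m=z_n$, $\gamma/[m]$ if $x_n=y_m\ne z_n$, $(1-\gamma)/[m]$ if $x_n\ne y_m=z_n$, and $0$ otherwise. Individual $n$, who faces the ranking $r_n$, clicks on outlet $m$ with probability $$\rho_{n,m}=\frac{r_{n,m}^{\alpha}\,v^*_{n,m}}{\sum_{m'}r_{n,m'}^{\alpha}\,v^*_{n,m'}},$$ where $r_{1,m}=1/M$ for all $m$ and $r_{n+1,m}=\frac{\kappa}{\kappa+1}r_{n,m}+\frac1{\kappa+1}\rho_{n,m}$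 with an integer $\kappa\ge1$. For a fixed signal $s$ let $J=\{m: y_m=s\}$ and $\rho_{N,J}=\sum_{m\in J}\rho_{N,m}$. Let $\theta_m(r)$ be the expectation of the probability of a click on $m$ at the ranking $r$ over one individual's private signals, and let the mean dynamics be $\hat r_1=r_1$, $\hat r_{n+1}=\frac{\kappa}{\kappa+1}\hat r_n+\frac1{\kappa+1}\theta(\hat r_n)$, with $\hat\rho_{n,J}=\sum_{m\in J}\theta_m(\hat r_n)$. Fix $\omega$ and $s$, and compare two realizations $y,y'$ of the outlets' signals, with sets $J,J'$ of outlets carrying $s$, such that either $1\le \#J\le\#J'\le\frac{M-1}2$ or $\frac{M+1}2\le\#J\le\#J'\le M-1$. (In particular $\#J'=\#J+1$ is allowed whenever $\#J\ne 0,\frac{M-1}2,M-1$; and when $\#J=\#J'$ the comparison holds both ways, so the quantities below depend only on $\#J$.) Let primes denote the quantities computed with $y'$. Then for all $\kappa\ge 1$ and $N\ge 1$, in particular for all large $N$ and $\kappa$: 1. for every sequence of private signals, used in both realizations, $\rho'_{N,J'}\le\rho_{N,J}$; 2. $\mathbb E[\rho'_{N,J'}]\le\mathbb E[\rho_{N,J}]$,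 where each expectation is over the private signals given $\omega$ and the respective signals of the outlets; 3. $\hat\rho'_{N,J'}\le\hat\rho_{N,J}$. 4. Moreover, there are rankings $x$ and $x'$, not depending on $\kappa$, with $\theta(x)=x$ and $\theta'(x')=x'$, such that for every $\kappa\ge1$, as $n\to\infty$, $\hat r_n\to x$, $\hat r'_n\to x'$, $\hat\rho_{n,J}\to\sum_{m\in J}x_m$ and $\hat\rho'_{n,J'}\to\sum_{m\in J'}x'_m$; and $\sum_{m\in J'}x'_m\le\sum_{m\in J}x_m$. -/

import Mathlib

open MeasureTheory ProbabilityTheory Filter Topology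

noncomputable section

namespace SearchModel

/-- The outlets (websites) carrying the signal `s`, when outlet `m` carries the signal `y m`. -/
def outlets {M : ℕ} (y : Fin M → Bool) (s : Bool) : Finset (Fin M) :=
  Finset.univ.filter fun m => y m = s

/-- The signal `y_K` carried by a majority of the outlets (`M` is odd, so there are no ties). -/
def majoritySignal {M : ℕ} (y : Fin M → Bool) : Bool :=
  decide (M < 2 * (outlets y true).card)

/-- The ranking-free value `v*` of outlet `m` for an individual with private signals
`a = (x, z)`, where `x` is about the state of the world and `z` about the majority of outlets.
The value is divided by the number `[m]` of outlets with the same signal as `m`. -/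
def rankFreeValue {M : ℕ} (γ : ℝ) (y : Fin M → Bool) (a : Bool × Bool) (m : Fin M) : ℝ :=
  if a.1 = y m ∧ y m = a.2 then 1 / ((outlets y (y m)).card : ℝ)
  else if a.1 = y m then γ / ((outlets y (y m)).card : ℝ)
  else if y m = a.2 then (1 - γ) / ((outlets y (y m)).card : ℝ)
  else 0

/-- The website choice function with attention bias `α`: the probability that an individual with
signals `a` who faces the ranking `r` clicks on outlet `m`. -/
def choice {M : ℕ} (α γ : ℝ) (y : Fin M → Bool) (r : Fin M → ℝ) (a : Bool × Bool)
    (m : Fin M) : ℝ :=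
  (r m) ^ α * rankFreeValue γ y a m / ∑ m' : Fin M, (r m') ^ α * rankFreeValue γ y a m'

/-- The uniform ranking. -/
def uniformRanking (M : ℕ) : Fin M → ℝ := fun _ => 1 / (M : ℝ)

/-- The popularity ranking with persistence `κ`, weights `ν = κ / (κ + 1)` and `1 - ν`, and initial
ranking `r₁`, along the sequence `σ` of private signals of the individuals.
Index `n` is the ranking faced by the `(n + 1)`-st individual. -/
def ranking {M : ℕ} (α γ : ℝ) (κ : ℕ) (y : Fin M → Bool) (r₁ : Fin M → ℝ)
    (σ : ℕ → Bool × Bool) : ℕ → Fin M → ℝ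
  | 0 => r₁
  | n + 1 => fun m =>
      (κ : ℝ) / (κ + 1) * ranking α γ κ y r₁ σ n m
        + 1 / ((κ : ℝ) + 1) * choice α γ y (ranking α γ κ y r₁ σ n) (σ n) m

/-- The total probability that the `(n + 1)`-st individual clicks on an outlet in `J`. -/
def clickProb {M : ℕ} (α γ : ℝ) (κ : ℕ) (y : Fin M → Bool) (r₁ : Fin M → ℝ)
    (σ : ℕ → Bool × Bool) (n : ℕ) (J : Finset (Fin M)) : ℝ :=
  ∑ m ∈ J, choice α γ y (ranking α γ κ y r₁ σ n) (σ n) m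

/-- `(X n, Z n)` are the random private signals of the individuals, given the state of the world
`ω` and the majority signal `yK`: `X n` equals `ω` with probability `p`, `Z n` equals `yK` with
probability `μ`, `X n` and `Z n` are independent, and the pairs are independent across
individuals. -/
structure IsSignalProcess {Ω : Type*} [MeasurableSpace Ω] (P : Measure Ω) (p μ : ℝ)
    (ω yK : Bool) (X Z : ℕ → Ω → Bool) : Prop where
  measurable_fst : ∀ n, Measurable (X n)
  measurable_snd : ∀ n, Measurable (Z n)
  prob_fst : ∀ n, P.real {w | X n w = ω} = p
  prob_snd : ∀ n, P.real {w | Z n w = yK} = μ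
  indep_pair : ∀ n, IndepFun (X n) (Z n) P
  indep : iIndepFun (fun n w => (X n w, Z n w)) P

/-- The probability that an individual has private signals `a`, given `ω` and `yK`. -/
def signalWeight (p μ : ℝ) (ω yK : Bool) (a : Bool × Bool) : ℝ :=
  (if a.1 = ω then p else 1 - p) * (if a.2 = yK then μ else 1 - μ)

/-- The mean-dynamics map `θ`: the expected probability of a click on outlet `m` at the ranking `r`,
over the private signals of the individual who searches. -/
def theta {M : ℕ} (p μ α γ : ℝ) (ω : Bool) (y : Fin M → Bool) (r : Fin M → ℝ) (m : Fin M) : ℝ :=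
  ∑ a : Bool × Bool, signalWeight p μ ω (majoritySignal y) a * choice α γ y r a m

/-- The deterministic mean-dynamics ranking: the popularity ranking in which each individual's
clicking probabilities are replaced by their expectations over her private signals. -/
def meanRanking {M : ℕ} (p μ α γ : ℝ) (κ : ℕ) (ω : Bool) (y : Fin M → Bool)
    (r₁ : Fin M → ℝ) : ℕ → Fin M → ℝ
  | 0 => r₁
  | n + 1 => fun m =>
      (κ : ℝ) / (κ + 1) * meanRanking p μ α γ κ ω y r₁ n m
        + 1 / ((κ : ℝ) + 1) * theta p μ α γ ω y (meanRanking p μ α γ κ ω y r₁ n) m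

/-- The total mean-dynamics clicking probability of the `(n + 1)`-st individual on `J`. -/
def meanClickProb {M : ℕ} (p μ α γ : ℝ) (κ : ℕ) (ω : Bool) (y : Fin M → Bool)
    (r₁ : Fin M → ℝ) (n : ℕ) (J : Finset (Fin M)) : ℝ :=
  ∑ m ∈ J, theta p μ α γ ω y (meanRanking p μ α γ κ ω y r₁ n) m

end SearchModel

end

/-!
All outlets of a group (those carrying `s`, and those not) have the same ranking at the start and
the same ranking-free value for each individual, so they keep a common ranking forever, and the
whole ranking is described by one number: the share `R` of the group carrying `s` (`split`,
`choice_split`). The click probability on the group is a function of the private signals and of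
the ratio `t` between the ranking of one outlet of the group and of one outlet outside it
(`groupChoice`), and it is increasing in `t`. The size `k` of the group enters only through
`R = k t / (k t + M - k)`.

At the uniform ranking `t = 1` for every `k`. When clicks are averaged into the shares, the same
number of clicks raises the ranking of each outlet by less in a larger group, and the larger group
gets fewer clicks because its `t` is smaller. So the order of the ratios `t` is preserved
(`odds_le_of_average`), and with it the order of the click probabilities. This argument is the same
for every sequence of private signals and for the mean dynamics, because the law of
the signals depends on the outlets only through the majority signal, which is the same in both
realizations. The expectations are then integrals of ordered functions against one law
(`IsSignalProcess.map_eq`).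

The mean dynamics is a damped iteration of a continuous monotone self-map of `[0, 1]`. It converges
monotonically to the nearest fixed point in the direction of its first step, whatever the damping
`κ` (`exists_share_limit`). The limit may lie at the boundary; there `choice` has the junk value
`0 / 0` for some private signals, but these have probability zero (`theta_split_fixed`).
-/

namespace SearchModel

/-! ### Reduction to the share of one group of outlets -/

/-- The total ranking-free value of the outlets carrying `s`, for an individual with signals `a`;
the outlets carrying the other signal have total value `1 - groupValue γ s a`. -/
noncomputable def groupValue (γ : ℝ) (s : Bool) (a : Bool × Bool) : ℝ :=
  if a.1 = s ∧ a.2 = s then 1 else if a.1 = s then γ else if a.2 = s then 1 - γ else 0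

/-- The probability of a click on a group of `k` outlets with ranking share `R` and ranking-free
value `v`, when the other `j` outlets have ranking share `1 - R` and value `1 - v`, and the
ranking is uniform within both groups. The case `v = 1` is split off so that the function is
continuous at `R = 0`, where the quotient is `0 / 0` for `v = 1` and `0 < α`. -/
noncomputable def groupChoice (α v k j R : ℝ) : ℝ :=
  if v = 1 then 1 else v * (R / k) ^ α / (v * (R / k) ^ α + (1 - v) * ((1 - R) / j) ^ α)

/-- The ranking that gives total share `R` to the outlets carrying `s` and is uniform both on
these outlets and on the other ones. -/
noncomputable def split {M : ℕ} (y : Fin M → Bool) (s : Bool) (R : ℝ) : Fin M → ℝ := fun m =>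
  if y m = s then R / ((outlets y s).card : ℝ) else (1 - R) / ((M : ℝ) - (outlets y s).card)

/-- The share of a group of outlets under persistence `κ`, when the individual `n` who faces
the share `R` clicks on the group with probability `F n R`. -/
noncomputable def share (κ : ℕ) (F : ℕ → ℝ → ℝ) (R₀ : ℝ) : ℕ → ℝ
  | 0 => R₀
  | n + 1 => (κ : ℝ) / (κ + 1) * share κ F R₀ n + 1 / ((κ : ℝ) + 1) * F n (share κ F R₀ n)

/-- The expectation of `groupChoice` over the private signals of one individual. -/
noncomputable def meanGroupChoice (p μ α γ : ℝ) (ω yK s : Bool) (k j R : ℝ) : ℝ :=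
  ∑ a : Bool × Bool, signalWeight p μ ω yK a * groupChoice α (groupValue γ s a) k j R

lemma groupValue_mem {γ : ℝ} (hγ : 0 < γ ∧ γ < 1) (s : Bool) (a : Bool × Bool) :
    groupValue γ s a ∈ Set.Icc (0 : ℝ) 1 := by
  unfold groupValue
  split_ifs <;> constructor <;> linarith [hγ.1, hγ.2]

lemma card_outlets_add {M : ℕ} (y : Fin M → Bool) (s : Bool) :
    (outlets y s).card + (outlets y (!s)).card = M := by
  have h := Finset.card_filter_add_card_filter_not (s := (Finset.univ : Finset (Fin M)))
    (fun m => y m = s)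
  have h2 : outlets y (!s) = Finset.univ.filter fun m => ¬ y m = s := by
    ext m
    simp [outlets, Bool.eq_not]
  rw [h2]
  simpa [outlets] using h

lemma cast_card_outlets_not {M : ℕ} (y : Fin M → Bool) (s : Bool) :
    ((outlets y (!s)).card : ℝ) = (M : ℝ) - (outlets y s).card := by
  have h : ((outlets y s).card : ℝ) + (outlets y (!s)).card = M := by
    exact_mod_cast card_outlets_add y s
  linarith

lemma sum_ite_outlets {M : ℕ} (y : Fin M → Bool) (s : Bool) (A B : ℝ) :
    ∑ m, (if y m = s then A else B)
      = (outlets y s).card * A + ((M : ℝ) - (outlets y s).card) * B := by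
  rw [Finset.sum_ite, ← cast_card_outlets_not]
  have h2 : outlets y (!s) = Finset.univ.filter fun m => ¬ y m = s := by
    ext m
    simp [outlets, Bool.eq_not]
  rw [h2]
  simp [outlets]

lemma rankFreeValue_eq {M : ℕ} (γ : ℝ) (y : Fin M → Bool) (s : Bool) (a : Bool × Bool)
    (m : Fin M) :
    rankFreeValue γ y a m = if y m = s then groupValue γ s a / ((outlets y s).card : ℝ)
      else (1 - groupValue γ s a) / ((M : ℝ) - (outlets y s).card) := by
  have hc := cast_card_outlets_not y s
  obtain ⟨x, z⟩ := a
  unfold rankFreeValue groupValue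
  by_cases h : y m = s
  · subst h
    cases x <;> cases z <;> cases y m <;> simp
  · have h' : y m = !s := by simpa [Bool.eq_not] using h
    rw [if_neg h, h', hc]
    cases x <;> cases z <;> cases s <;> simp

lemma sum_split {M : ℕ} {y : Fin M → Bool} {s : Bool} (hpos : 0 < (outlets y s).card) (R : ℝ) :
    ∑ m ∈ outlets y s, split y s R m = R := by
  have h : ∀ m ∈ outlets y s, split y s R m = R / ((outlets y s).card : ℝ) := by
    intro m hm
    exact if_pos (Finset.mem_filter.1 hm).2
  have : ((outlets y s).card : ℝ) ≠ 0 := by positivity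
  rw [Finset.sum_congr rfl h, Finset.sum_const, nsmul_eq_mul]
  field_simp

lemma uniformRanking_eq_split {M : ℕ} {y : Fin M → Bool} {s : Bool}
    (hpos : 0 < (outlets y s).card) (hlt : (outlets y s).card < M) :
    uniformRanking M = split y s ((outlets y s).card / M) := by
  have hk : (0 : ℝ) < (outlets y s).card := by exact_mod_cast hpos
  have hj : (0 : ℝ) < (M : ℝ) - (outlets y s).card := by
    have : ((outlets y s).card : ℝ) < M := by exact_mod_cast hlt
    linarith
  have hM : (0 : ℝ) < M := by linarith
  funext m
  unfold uniformRanking split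
  split_ifs <;> field_simp

/-- A ranking that is uniform on both groups leads to clicking probabilities that are uniform on
both groups. The hypothesis excludes the quotients `0 / 0`. -/
lemma choice_split {M : ℕ} {α γ : ℝ} {y : Fin M → Bool} {s : Bool} {a : Bool × Bool} {R : ℝ}
    (hpos : 0 < (outlets y s).card) (hlt : (outlets y s).card < M)
    (hD : groupValue γ s a * (R / ((outlets y s).card : ℝ)) ^ α
      + (1 - groupValue γ s a) * ((1 - R) / ((M : ℝ) - (outlets y s).card)) ^ α ≠ 0) :
    choice α γ y (split y s R) a
      = split y s (groupChoice α (groupValue γ s a) (outlets y s).card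
          ((M : ℝ) - (outlets y s).card) R) := by
  have hk : (0 : ℝ) < (outlets y s).card := by exact_mod_cast hpos
  have hj : (0 : ℝ) < (M : ℝ) - (outlets y s).card := by
    have : ((outlets y s).card : ℝ) < M := by exact_mod_cast hlt
    linarith
  have hterm : ∀ m, split y s R m ^ α * rankFreeValue γ y a m = if y m = s then
      (R / ((outlets y s).card : ℝ)) ^ α * (groupValue γ s a / ((outlets y s).card : ℝ))
      else ((1 - R) / ((M : ℝ) - (outlets y s).card)) ^ α
        * ((1 - groupValue γ s a) / ((M : ℝ) - (outlets y s).card)) := by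
    intro m
    rw [rankFreeValue_eq γ y s]
    unfold split
    split_ifs <;> rfl
  funext m
  unfold choice
  simp_rw [hterm]
  rw [sum_ite_outlets]
  unfold groupChoice
  simp only [split]
  generalize groupValue γ s a = v at *
  generalize ((outlets y s).card : ℝ) = k at *
  generalize (M : ℝ) - k = j at *
  generalize (R / k) ^ α = A at *
  generalize ((1 - R) / j) ^ α = B at *
  have hD' : k * (A * (v / k)) + j * (B * ((1 - v) / j)) = v * A + (1 - v) * B := by
    field_simp
  rw [hD']
  by_cases hv : v = 1
  · subst hv
    have hA : A ≠ 0 := by simpa using hD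
    rw [if_pos rfl]
    split_ifs
    · rw [sub_self, zero_mul, add_zero, one_mul]
      field_simp
    · simp
  · rw [if_neg hv]
    split_ifs
    · field_simp
    · rw [one_sub_div hD, div_div, mul_div_assoc', div_div, mul_comm j]
      congr 1
      ring

lemma groupChoice_denom_pos {α v k j R : ℝ} (hk : 0 < k) (hj : 0 < j) (hv : v ∈ Set.Icc (0 : ℝ) 1)
    (hR : R ∈ Set.Ioo (0 : ℝ) 1) : 0 < v * (R / k) ^ α + (1 - v) * ((1 - R) / j) ^ α := by
  have hA : 0 < (R / k) ^ α := Real.rpow_pos_of_pos (div_pos hR.1 hk) _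
  have hB : 0 < ((1 - R) / j) ^ α := Real.rpow_pos_of_pos (div_pos (by linarith [hR.2]) hj) _
  rcases hv.1.eq_or_lt with h | h
  · rw [← h]
    simpa using hB
  · exact add_pos_of_pos_of_nonneg (mul_pos h hA) (mul_nonneg (by linarith [hv.2]) hB.le)

lemma groupChoice_denom_pos_of_mem_Ioo {α v k j R : ℝ} (hk : 0 < k) (hj : 0 < j)
    (hv : v ∈ Set.Ioo (0 : ℝ) 1) (hR : R ∈ Set.Icc (0 : ℝ) 1) :
    0 < v * (R / k) ^ α + (1 - v) * ((1 - R) / j) ^ α := by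
  have hv' : 0 < 1 - v := by linarith [hv.2]
  have hA : 0 ≤ (R / k) ^ α := Real.rpow_nonneg (div_nonneg hR.1 hk.le) _
  have hB : 0 ≤ ((1 - R) / j) ^ α :=
    Real.rpow_nonneg (div_nonneg (by linarith [hR.2]) hj.le) _
  rcases hR.1.eq_or_lt with h | h
  · have : 0 < ((1 - R) / j) ^ α := Real.rpow_pos_of_pos (div_pos (by linarith) hj) _
    exact add_pos_of_nonneg_of_pos (mul_nonneg hv.1.le hA) (mul_pos hv' this)
  · have : 0 < (R / k) ^ α := Real.rpow_pos_of_pos (div_pos h hk) _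
    exact add_pos_of_pos_of_nonneg (mul_pos hv.1 this) (mul_nonneg hv'.le hB)

lemma groupChoice_mem {α v k j R : ℝ} (hk : 0 < k) (hj : 0 < j) (hv : v ∈ Set.Icc (0 : ℝ) 1)
    (hR : R ∈ Set.Icc (0 : ℝ) 1) : groupChoice α v k j R ∈ Set.Icc (0 : ℝ) 1 := by
  unfold groupChoice
  split_ifs
  · simp
  · have hA : 0 ≤ v * (R / k) ^ α :=
      mul_nonneg hv.1 (Real.rpow_nonneg (div_nonneg hR.1 hk.le) _)
    have hB : 0 ≤ (1 - v) * ((1 - R) / j) ^ α := mul_nonneg (by linarith [hv.2])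
      (Real.rpow_nonneg (div_nonneg (by linarith [hR.2]) hj.le) _)
    exact ⟨div_nonneg hA (add_nonneg hA hB), div_le_one_of_le₀ (by linarith) (add_nonneg hA hB)⟩

lemma groupChoice_zero_left {α k j R : ℝ} : groupChoice α 0 k j R = 0 := by
  simp [groupChoice]

lemma groupChoice_one_left {α k j R : ℝ} : groupChoice α 1 k j R = 1 := by
  simp [groupChoice]

/-! ### Comparing two group sizes -/

/-- The click probability is monotone in the ratio of the rankings of single outlets in and
outside the group: the hypothesis says that `(R' / k') / ((1 - R') / j') ≤ (R / k) / ((1 - R) / j)`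
with denominators cleared. -/
lemma groupChoice_le {α v k j k' j' R R' : ℝ} (hα : 0 ≤ α) (hk : 0 < k) (hj : 0 < j)
    (hk' : 0 < k') (hj' : 0 < j') (hv : v ∈ Set.Icc (0 : ℝ) 1) (hR : R ∈ Set.Icc (0 : ℝ) 1)
    (hR' : R' ∈ Set.Icc (0 : ℝ) 1) (h : R' * (1 - R) * (j' * k) ≤ R * (1 - R') * (j * k')) :
    groupChoice α v k' j' R' ≤ groupChoice α v k j R := by
  rcases hv.1.eq_or_lt with h0 | h0
  · rw [← h0, groupChoice_zero_left, groupChoice_zero_left]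
  rcases hv.2.eq_or_lt with h1 | h1
  · rw [h1, groupChoice_one_left, groupChoice_one_left]
  have hD := groupChoice_denom_pos_of_mem_Ioo (α := α) hk hj ⟨h0, h1⟩ hR
  have hD' := groupChoice_denom_pos_of_mem_Ioo (α := α) hk' hj' ⟨h0, h1⟩ hR'
  have r1 : 0 ≤ R / k := div_nonneg hR.1 hk.le
  have r2 : 0 ≤ R' / k' := div_nonneg hR'.1 hk'.le
  have r3 : 0 ≤ (1 - R) / j := div_nonneg (by linarith [hR.2]) hj.le
  have r4 : 0 ≤ (1 - R') / j' := div_nonneg (by linarith [hR'.2]) hj'.le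
  have key : (R' / k') ^ α * ((1 - R) / j) ^ α ≤ (R / k) ^ α * ((1 - R') / j') ^ α := by
    rw [← Real.mul_rpow r2 r3, ← Real.mul_rpow r1 r4]
    refine Real.rpow_le_rpow (mul_nonneg r2 r3) ?_ hα
    rw [div_mul_div_comm, div_mul_div_comm, div_le_div_iff₀ (by positivity) (by positivity)]
    linarith
  unfold groupChoice
  rw [if_neg h1.ne, if_neg h1.ne, div_le_div_iff₀ hD' hD]
  have := mul_le_mul_of_nonneg_left key (mul_nonneg h0.le (sub_nonneg.2 h1.le))
  linarith

lemma share_mem {κ : ℕ} (hκ : 1 ≤ κ) {F : ℕ → ℝ → ℝ} {R₀ : ℝ} (hR₀ : R₀ ∈ Set.Ioo (0 : ℝ) 1)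
    (hF : ∀ n, ∀ R ∈ Set.Ioo (0 : ℝ) 1, F n R ∈ Set.Icc (0 : ℝ) 1) (n : ℕ) :
    share κ F R₀ n ∈ Set.Ioo (0 : ℝ) 1 := by
  induction n with
  | zero => exact hR₀
  | succ n ih =>
    have hκ' : (1 : ℝ) ≤ κ := by exact_mod_cast hκ
    have h := hF n _ ih
    rw [share, div_mul_eq_mul_div, div_mul_eq_mul_div, ← add_div]
    constructor
    · have := mul_pos (by linarith : (0 : ℝ) < κ) ih.1
      exact div_pos (by linarith [h.1]) (by linarith)
    · rw [div_lt_one (by linarith)]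
      have := mul_lt_mul_of_pos_left ih.2 (by linarith : (0 : ℝ) < κ)
      linarith [h.2]

/-- Averaging the shares with clicking probabilities preserves the order of the ratios of the
rankings of single outlets, if the smaller group gets at least as many clicks. -/
lemma odds_le_of_average {ν k j k' j' R R' g g' : ℝ} (hν : 0 ≤ ν ∧ ν ≤ 1) (hk : 0 < k)
    (hkk : k ≤ k') (hj' : 0 < j') (hjj : j' ≤ j) (hR : R ∈ Set.Ioo (0 : ℝ) 1)
    (hR' : R' ∈ Set.Ioo (0 : ℝ) 1) (hg : g ∈ Set.Icc (0 : ℝ) 1) (hg' : g' ∈ Set.Icc (0 : ℝ) 1)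
    (hgg : g' ≤ g) (h : R' * (1 - R) * (j' * k) ≤ R * (1 - R') * (j * k')) :
    (ν * R' + (1 - ν) * g') * (1 - (ν * R + (1 - ν) * g)) * (j' * k)
      ≤ (ν * R + (1 - ν) * g) * (1 - (ν * R' + (1 - ν) * g')) * (j * k') := by
  obtain ⟨hR0, hR1⟩ := hR
  obtain ⟨hR0', hR1'⟩ := hR'
  have hc0 : 0 < j' * k := mul_pos hj' hk
  have hc : j' * k ≤ j * k' := mul_le_mul hjj hkk hk.le (by linarith)
  generalize j' * k = c' at *
  generalize j * k' = c at *
  have h1 : R' * c' ≤ R * c := by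
    rcases le_total R' R with hle | hle
    · exact mul_le_mul hle hc hc0.le hR0.le
    · have : R * (1 - R') * c ≤ R * (1 - R) * c := by gcongr; linarith
      have h3 : (1 - R) * (R' * c') ≤ (1 - R) * (R * c) := by linarith
      exact le_of_mul_le_mul_left h3 (by linarith)
  have h2 : (1 - R) * c' ≤ (1 - R') * c := by
    rcases le_total R' R with hle | hle
    · exact mul_le_mul (by linarith) hc hc0.le (by linarith)
    · have : R * (1 - R') * c ≤ R' * (1 - R') * c := by gcongr; linarith
      have h3 : R' * ((1 - R) * c') ≤ R' * ((1 - R') * c) := by linarith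
      exact le_of_mul_le_mul_left h3 hR0'
  have e1 : R' * c' * (1 - g) ≤ R * c * (1 - g') :=
    mul_le_mul h1 (by linarith) (by linarith [hg.2]) (by nlinarith)
  have e2 : (1 - R) * c' * g' ≤ (1 - R') * c * g :=
    mul_le_mul h2 hgg hg'.1 (mul_nonneg (by linarith) (by linarith))
  have e3 : g' * (1 - g) * c' ≤ g * (1 - g') * c :=
    mul_le_mul (mul_le_mul hgg (by linarith) (by linarith [hg.2]) hg.1) hc hc0.le
      (mul_nonneg hg.1 (by linarith [hg'.2]))
  have hν' : 0 ≤ 1 - ν := by linarith [hν.2]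
  have f1 := mul_le_mul_of_nonneg_left h (mul_nonneg hν.1 hν.1)
  have f2 := mul_le_mul_of_nonneg_left (add_le_add e1 e2) (mul_nonneg hν.1 hν')
  have f3 := mul_le_mul_of_nonneg_left e3 (mul_nonneg hν' hν')
  -- Expanding in powers of `ν` and `1 - ν`, with `1 = ν + (1 - ν)` in the second factors.
  linear_combination f1 + f2 + f3

lemma share_odds_le {κ : ℕ} (hκ : 1 ≤ κ) {F F' : ℕ → ℝ → ℝ} {k j k' j' : ℝ} (hk : 0 < k)
    (hkk : k ≤ k') (hj' : 0 < j') (hjj : j' ≤ j)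
    (hF : ∀ n, ∀ R ∈ Set.Ioo (0 : ℝ) 1, F n R ∈ Set.Icc (0 : ℝ) 1)
    (hF' : ∀ n, ∀ R ∈ Set.Ioo (0 : ℝ) 1, F' n R ∈ Set.Icc (0 : ℝ) 1)
    (hFF : ∀ n, ∀ R ∈ Set.Ioo (0 : ℝ) 1, ∀ R' ∈ Set.Ioo (0 : ℝ) 1,
      R' * (1 - R) * (j' * k) ≤ R * (1 - R') * (j * k') → F' n R' ≤ F n R)
    {R₀ R₀' : ℝ} (hR₀ : R₀ ∈ Set.Ioo (0 : ℝ) 1) (hR₀' : R₀' ∈ Set.Ioo (0 : ℝ) 1)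
    (h : R₀' * (1 - R₀) * (j' * k) ≤ R₀ * (1 - R₀') * (j * k')) (n : ℕ) :
    share κ F' R₀' n * (1 - share κ F R₀ n) * (j' * k)
      ≤ share κ F R₀ n * (1 - share κ F' R₀' n) * (j * k') := by
  induction n with
  | zero => exact h
  | succ n ih =>
    have m := share_mem hκ hR₀ hF n
    have m' := share_mem hκ hR₀' hF' n
    have hν : (1 : ℝ) / ((κ : ℝ) + 1) = 1 - (κ : ℝ) / (κ + 1) := by
      field_simp
      ring
    have hb : 0 ≤ (κ : ℝ) / (κ + 1) ∧ (κ : ℝ) / (κ + 1) ≤ 1 :=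
      ⟨by positivity, div_le_one_of_le₀ (by linarith) (by positivity)⟩
    simp only [share, hν]
    exact odds_le_of_average hb hk hkk hj' hjj m m' (hF n _ m) (hF' n _ m') (hFF n _ m _ m' ih) ih

/-- At the uniform ranking all outlets are ranked alike, whatever the sizes of the groups, so the
comparison of the ratios holds at the start. -/
lemma share_le {κ : ℕ} (hκ : 1 ≤ κ) {F F' : ℕ → ℝ → ℝ} {k k' N : ℝ} (hk : 0 < k)
    (hkk : k ≤ k') (hN : k' < N)
    (hF : ∀ n, ∀ R ∈ Set.Ioo (0 : ℝ) 1, F n R ∈ Set.Icc (0 : ℝ) 1)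
    (hF' : ∀ n, ∀ R ∈ Set.Ioo (0 : ℝ) 1, F' n R ∈ Set.Icc (0 : ℝ) 1)
    (hFF : ∀ n, ∀ R ∈ Set.Ioo (0 : ℝ) 1, ∀ R' ∈ Set.Ioo (0 : ℝ) 1,
      R' * (1 - R) * ((N - k') * k) ≤ R * (1 - R') * ((N - k) * k') → F' n R' ≤ F n R) (n : ℕ) :
    F' n (share κ F' (k' / N) n) ≤ F n (share κ F (k / N) n) := by
  have hN0 : 0 < N := by linarith
  have m : k / N ∈ Set.Ioo (0 : ℝ) 1 :=
    ⟨by positivity, (div_lt_one hN0).2 (by linarith)⟩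
  have m' : k' / N ∈ Set.Ioo (0 : ℝ) 1 :=
    ⟨div_pos (by linarith) hN0, (div_lt_one hN0).2 (by linarith)⟩
  refine hFF n _ (share_mem hκ m hF n) _ (share_mem hκ m' hF' n)
    (share_odds_le hκ hk hkk (by linarith) (by linarith) hF hF' hFF m m' (le_of_eq ?_) n)
  field_simp

/-! ### The ranking and the mean dynamics in terms of shares -/

lemma split_average {M : ℕ} (y : Fin M → Bool) (s : Bool) (κ : ℕ) (R g : ℝ) (m : Fin M) :
    (κ : ℝ) / (κ + 1) * split y s R m + 1 / ((κ : ℝ) + 1) * split y s g m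
      = split y s ((κ : ℝ) / (κ + 1) * R + 1 / ((κ : ℝ) + 1) * g) m := by
  have hκ : (1 : ℝ) = (κ : ℝ) / (κ + 1) + 1 / ((κ : ℝ) + 1) := by field_simp
  unfold split
  split_ifs
  · ring
  · generalize (κ : ℝ) / (κ + 1) = ν at *
    generalize 1 / ((κ : ℝ) + 1) = ν' at *
    rw [mul_div_assoc', mul_div_assoc', ← add_div]
    congr 1
    linear_combination -hκ

section Group

variable {M : ℕ} {y : Fin M → Bool} {s : Bool}

lemma choice_split_of_mem {α γ : ℝ} {a : Bool × Bool} {R : ℝ} (hγ : 0 < γ ∧ γ < 1)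
    (hpos : 0 < (outlets y s).card) (hlt : (outlets y s).card < M)
    (hR : R ∈ Set.Ioo (0 : ℝ) 1) :
    choice α γ y (split y s R) a
      = split y s (groupChoice α (groupValue γ s a) (outlets y s).card
          ((M : ℝ) - (outlets y s).card) R) := by
  have hlt' : ((outlets y s).card : ℝ) < M := by exact_mod_cast hlt
  exact choice_split hpos hlt (groupChoice_denom_pos (by exact_mod_cast hpos) (by linarith)
    (groupValue_mem hγ s a) hR).ne'

lemma initial_share_mem (hpos : 0 < (outlets y s).card) (hlt : (outlets y s).card < M) :
    ((outlets y s).card : ℝ) / M ∈ Set.Ioo (0 : ℝ) 1 := by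
  have hk : (0 : ℝ) < (outlets y s).card := by exact_mod_cast hpos
  have hlt' : ((outlets y s).card : ℝ) < M := by exact_mod_cast hlt
  exact ⟨div_pos hk (by linarith), (div_lt_one (by linarith)).2 hlt'⟩

lemma groupChoice_outlets_mem (α : ℝ) {γ : ℝ} (hγ : 0 < γ ∧ γ < 1)
    (hpos : 0 < (outlets y s).card) (hlt : (outlets y s).card < M) (a : Bool × Bool)
    {R : ℝ} (hR : R ∈ Set.Ioo (0 : ℝ) 1) :
    groupChoice α (groupValue γ s a) (outlets y s).card ((M : ℝ) - (outlets y s).card) R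
      ∈ Set.Icc (0 : ℝ) 1 := by
  have hlt' : ((outlets y s).card : ℝ) < M := by exact_mod_cast hlt
  exact groupChoice_mem (by exact_mod_cast hpos) (by linarith) (groupValue_mem hγ s a)
    ⟨hR.1.le, hR.2.le⟩

lemma ranking_eq_split {α γ : ℝ} (hγ : 0 < γ ∧ γ < 1) (hpos : 0 < (outlets y s).card)
    (hlt : (outlets y s).card < M) {κ : ℕ} (hκ : 1 ≤ κ) (σ : ℕ → Bool × Bool) (n : ℕ) :
    ranking α γ κ y (uniformRanking M) σ n
      = split y s (share κ (fun i => groupChoice α (groupValue γ s (σ i)) (outlets y s).card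
          ((M : ℝ) - (outlets y s).card)) ((outlets y s).card / M) n) := by
  induction n with
  | zero => exact uniformRanking_eq_split hpos hlt
  | succ n ih =>
    have m := share_mem hκ (initial_share_mem hpos hlt)
      (fun i R hR => groupChoice_outlets_mem α hγ hpos hlt (σ i) hR) n
    funext i
    simp only [ranking, share]
    rw [ih, choice_split_of_mem hγ hpos hlt m, split_average]

lemma clickProb_eq {α γ : ℝ} (hγ : 0 < γ ∧ γ < 1) (hpos : 0 < (outlets y s).card)
    (hlt : (outlets y s).card < M) {κ : ℕ} (hκ : 1 ≤ κ) (σ : ℕ → Bool × Bool) (n : ℕ) :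
    clickProb α γ κ y (uniformRanking M) σ n (outlets y s)
      = groupChoice α (groupValue γ s (σ n)) (outlets y s).card ((M : ℝ) - (outlets y s).card)
        (share κ (fun i => groupChoice α (groupValue γ s (σ i)) (outlets y s).card
          ((M : ℝ) - (outlets y s).card)) ((outlets y s).card / M) n) := by
  have m := share_mem hκ (initial_share_mem hpos hlt)
    (fun i R hR => groupChoice_outlets_mem α hγ hpos hlt (σ i) hR) n
  rw [clickProb, ranking_eq_split hγ hpos hlt hκ, choice_split_of_mem hγ hpos hlt m,
    sum_split hpos]

lemma sum_signalWeight (p μ : ℝ) (ω yK : Bool) : ∑ a, signalWeight p μ ω yK a = 1 := by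
  rw [Fintype.sum_prod_type]
  cases ω <;> cases yK <;> simp [signalWeight] <;> ring

lemma signalWeight_nonneg {p μ : ℝ} (hp : 1 / 2 < p ∧ p < 1) (hμ : 1 / 2 < μ ∧ μ ≤ 1)
    (ω yK : Bool) (a : Bool × Bool) : 0 ≤ signalWeight p μ ω yK a := by
  unfold signalWeight
  apply mul_nonneg <;> split_ifs <;> linarith [hp.1, hp.2, hμ.1, hμ.2]

lemma sum_mul_split {w : Bool × Bool → ℝ} (hw : ∑ a, w a = 1) (f : Bool × Bool → ℝ) (m : Fin M) :
    ∑ a, w a * split y s (f a) m = split y s (∑ a, w a * f a) m := by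
  unfold split
  split_ifs
  · simp_rw [mul_div_assoc']
    rw [Finset.sum_div]
  · simp_rw [mul_div_assoc', mul_sub, mul_one]
    rw [← Finset.sum_div, Finset.sum_sub_distrib, hw]

lemma meanGroupChoice_mem {p μ α γ : ℝ} (hp : 1 / 2 < p ∧ p < 1) (hμ : 1 / 2 < μ ∧ μ ≤ 1)
    (hγ : 0 < γ ∧ γ < 1) (ω yK s : Bool) {k j R : ℝ} (hk : 0 < k) (hj : 0 < j)
    (hR : R ∈ Set.Icc (0 : ℝ) 1) : meanGroupChoice p μ α γ ω yK s k j R ∈ Set.Icc (0 : ℝ) 1 := by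
  unfold meanGroupChoice
  constructor
  · exact Finset.sum_nonneg fun a _ => mul_nonneg (signalWeight_nonneg hp hμ ω yK a)
      (groupChoice_mem hk hj (groupValue_mem hγ s a) hR).1
  · calc _ ≤ ∑ a, signalWeight p μ ω yK a := Finset.sum_le_sum fun a _ =>
          mul_le_of_le_one_right (signalWeight_nonneg hp hμ ω yK a)
            (groupChoice_mem hk hj (groupValue_mem hγ s a) hR).2
      _ = 1 := sum_signalWeight p μ ω yK

lemma meanGroupChoice_le {p μ α γ : ℝ} (hp : 1 / 2 < p ∧ p < 1) (hμ : 1 / 2 < μ ∧ μ ≤ 1)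
    (hγ : 0 < γ ∧ γ < 1) (hα : 0 ≤ α) (ω yK s : Bool) {k j k' j' R R' : ℝ} (hk : 0 < k)
    (hj : 0 < j) (hk' : 0 < k') (hj' : 0 < j') (hR : R ∈ Set.Icc (0 : ℝ) 1)
    (hR' : R' ∈ Set.Icc (0 : ℝ) 1) (h : R' * (1 - R) * (j' * k) ≤ R * (1 - R') * (j * k')) :
    meanGroupChoice p μ α γ ω yK s k' j' R' ≤ meanGroupChoice p μ α γ ω yK s k j R :=
  Finset.sum_le_sum fun a _ => mul_le_mul_of_nonneg_left
    (groupChoice_le hα hk hj hk' hj' (groupValue_mem hγ s a) hR hR' h)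
    (signalWeight_nonneg hp hμ ω yK a)

lemma meanGroupChoice_outlets_mem {p μ : ℝ} (α : ℝ) {γ : ℝ} (hp : 1 / 2 < p ∧ p < 1)
    (hμ : 1 / 2 < μ ∧ μ ≤ 1) (hγ : 0 < γ ∧ γ < 1) (ω yK : Bool) (hpos : 0 < (outlets y s).card)
    (hlt : (outlets y s).card < M) {R : ℝ} (hR : R ∈ Set.Ioo (0 : ℝ) 1) :
    meanGroupChoice p μ α γ ω yK s (outlets y s).card ((M : ℝ) - (outlets y s).card) R
      ∈ Set.Icc (0 : ℝ) 1 := by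
  have hlt' : ((outlets y s).card : ℝ) < M := by exact_mod_cast hlt
  exact meanGroupChoice_mem hp hμ hγ ω yK s (by exact_mod_cast hpos) (by linarith)
    ⟨hR.1.le, hR.2.le⟩

lemma theta_split_of_mem {p μ α γ : ℝ} (hγ : 0 < γ ∧ γ < 1) (ω : Bool)
    (hpos : 0 < (outlets y s).card) (hlt : (outlets y s).card < M) {R : ℝ}
    (hR : R ∈ Set.Ioo (0 : ℝ) 1) :
    theta p μ α γ ω y (split y s R) = split y s (meanGroupChoice p μ α γ ω (majoritySignal y) s
      (outlets y s).card ((M : ℝ) - (outlets y s).card) R) := by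
  funext m
  unfold theta meanGroupChoice
  rw [← sum_mul_split (sum_signalWeight p μ ω _)]
  simp_rw [choice_split_of_mem hγ hpos hlt hR]

/-- At a boundary fixed point, the signals that leave no outlet with a positive value have
probability zero, so the junk value of `choice` for these signals does not matter. -/
lemma theta_split_fixed {p μ α γ : ℝ} (hp : 1 / 2 < p ∧ p < 1) (hμ : 1 / 2 < μ ∧ μ ≤ 1)
    (hγ : 0 < γ ∧ γ < 1) (ω : Bool) (hpos : 0 < (outlets y s).card)
    (hlt : (outlets y s).card < M) {L : ℝ} (hL : L ∈ Set.Icc (0 : ℝ) 1)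
    (hfix : meanGroupChoice p μ α γ ω (majoritySignal y) s (outlets y s).card
      ((M : ℝ) - (outlets y s).card) L = L) :
    theta p μ α γ ω y (split y s L) = split y s L := by
  have hk : (0 : ℝ) < (outlets y s).card := by exact_mod_cast hpos
  have hj : (0 : ℝ) < (M : ℝ) - (outlets y s).card := by
    have : ((outlets y s).card : ℝ) < M := by exact_mod_cast hlt
    linarith
  have hw := signalWeight_nonneg hp hμ ω (majoritySignal y)
  have hg := fun a => groupChoice_mem (α := α) hk hj (groupValue_mem hγ s a) hL
  funext m
  conv_rhs => rw [← hfix]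
  unfold theta
  rw [meanGroupChoice, ← sum_mul_split (sum_signalWeight p μ ω _)]
  refine Finset.sum_congr rfl fun a _ => ?_
  by_cases hwa : signalWeight p μ ω (majoritySignal y) a = 0
  · rw [hwa, zero_mul, zero_mul]
  have hwa' := lt_of_le_of_ne (hw a) (Ne.symm hwa)
  rw [choice_split hpos hlt (ne_of_gt ?_)]
  have hv := groupValue_mem hγ s a
  rcases hv.1.eq_or_lt with h0 | h0
  · -- Value `0` with positive probability keeps the fixed point below `1`.
    have hL1 : L ≠ 1 := by
      rintro rfl
      have : meanGroupChoice p μ α γ ω (majoritySignal y) s (outlets y s).card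
          ((M : ℝ) - (outlets y s).card) 1 < ∑ a, signalWeight p μ ω (majoritySignal y) a := by
        refine Finset.sum_lt_sum (fun b _ => mul_le_of_le_one_right (hw b) (hg b).2)
          ⟨a, Finset.mem_univ a, ?_⟩
        rw [← h0, groupChoice_zero_left, mul_zero]
        exact hwa'
      rw [hfix, sum_signalWeight] at this
      exact lt_irrefl _ this
    have : 0 < ((1 - L) / ((M : ℝ) - (outlets y s).card)) ^ α :=
      Real.rpow_pos_of_pos (div_pos (by linarith [lt_of_le_of_ne hL.2 hL1]) hj) _
    simpa [← h0] using this
  rcases hv.2.eq_or_lt with h1 | h1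
  · -- Value `1` with positive probability keeps the fixed point above `0`.
    have hL0 : L ≠ 0 := by
      rintro rfl
      have : 0 < meanGroupChoice p μ α γ ω (majoritySignal y) s (outlets y s).card
          ((M : ℝ) - (outlets y s).card) 0 := by
        refine Finset.sum_pos' (fun b _ => mul_nonneg (hw b) (hg b).1)
          ⟨a, Finset.mem_univ a, ?_⟩
        rw [h1, groupChoice_one_left, mul_one]
        exact hwa'
      rw [hfix] at this
      exact lt_irrefl _ this
    have : 0 < (L / ((outlets y s).card : ℝ)) ^ α :=
      Real.rpow_pos_of_pos (div_pos (lt_of_le_of_ne hL.1 (Ne.symm hL0)) hk) _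
    simpa [h1] using this
  exact groupChoice_denom_pos_of_mem_Ioo hk hj ⟨h0, h1⟩ hL

lemma meanRanking_eq_split {p μ α γ : ℝ} (hp : 1 / 2 < p ∧ p < 1) (hμ : 1 / 2 < μ ∧ μ ≤ 1)
    (hγ : 0 < γ ∧ γ < 1) (ω : Bool) (hpos : 0 < (outlets y s).card)
    (hlt : (outlets y s).card < M) {κ : ℕ} (hκ : 1 ≤ κ) (n : ℕ) :
    meanRanking p μ α γ κ ω y (uniformRanking M) n
      = split y s (share κ (fun _ => meanGroupChoice p μ α γ ω (majoritySignal y) s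
          (outlets y s).card ((M : ℝ) - (outlets y s).card)) ((outlets y s).card / M) n) := by
  induction n with
  | zero => exact uniformRanking_eq_split hpos hlt
  | succ n ih =>
    have m := share_mem hκ (initial_share_mem hpos hlt)
      (fun _ R hR => meanGroupChoice_outlets_mem α hp hμ hγ ω (majoritySignal y) hpos hlt hR) n
    funext i
    simp only [meanRanking, share]
    rw [ih, theta_split_of_mem hγ ω hpos hlt m, split_average]

lemma meanClickProb_eq {p μ α γ : ℝ} (hp : 1 / 2 < p ∧ p < 1) (hμ : 1 / 2 < μ ∧ μ ≤ 1)
    (hγ : 0 < γ ∧ γ < 1) (ω : Bool) (hpos : 0 < (outlets y s).card)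
    (hlt : (outlets y s).card < M) {κ : ℕ} (hκ : 1 ≤ κ) (n : ℕ) :
    meanClickProb p μ α γ κ ω y (uniformRanking M) n (outlets y s)
      = meanGroupChoice p μ α γ ω (majoritySignal y) s (outlets y s).card
        ((M : ℝ) - (outlets y s).card)
        (share κ (fun _ => meanGroupChoice p μ α γ ω (majoritySignal y) s
          (outlets y s).card ((M : ℝ) - (outlets y s).card)) ((outlets y s).card / M) n) := by
  have m := share_mem hκ (initial_share_mem hpos hlt)
    (fun _ R hR => meanGroupChoice_outlets_mem α hp hμ hγ ω (majoritySignal y) hpos hlt hR) n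
  rw [meanClickProb, meanRanking_eq_split hp hμ hγ ω hpos hlt hκ,
    theta_split_of_mem hγ ω hpos hlt m, sum_split hpos]

end Group

/-! ### Convergence of the mean dynamics -/

/-- The limit is the least point at or above `R₀` that `Φ` does not move up; it does not depend
on `κ`. -/
lemma exists_share_limit_of_le {Φ : ℝ → ℝ} (hmaps : Set.MapsTo Φ (Set.Icc 0 1) (Set.Icc 0 1))
    (hmono : MonotoneOn Φ (Set.Icc 0 1)) (hcont : ContinuousOn Φ (Set.Icc 0 1)) {R₀ : ℝ}
    (hR₀ : R₀ ∈ Set.Icc (0 : ℝ) 1) (hle : R₀ ≤ Φ R₀) :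
    ∃ L ∈ Set.Icc (0 : ℝ) 1, Φ L = L ∧
      ∀ κ : ℕ, Tendsto (share κ (fun _ => Φ) R₀) atTop (𝓝 L) := by
  set S : Set ℝ := {u | u ∈ Set.Icc R₀ 1 ∧ Φ u ≤ u} with hS
  have hsub : Set.Icc R₀ 1 ⊆ Set.Icc (0 : ℝ) 1 := Set.Icc_subset_Icc_left hR₀.1
  have hSc : IsClosed S :=
    isClosed_Icc.isClosed_le (hcont.mono hsub) continuousOn_id
  have h1 : (1 : ℝ) ∈ S := ⟨⟨hR₀.2, le_rfl⟩, (hmaps ⟨zero_le_one, le_rfl⟩).2⟩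
  have hbdd : BddBelow S := ⟨R₀, fun u hu => hu.1.1⟩
  set L := sInf S with hL
  have hLS : L ∈ S := hSc.csInf_mem ⟨1, h1⟩ hbdd
  have hL01 : L ∈ Set.Icc (0 : ℝ) 1 := hsub hLS.1
  have hbelow : ∀ u, R₀ ≤ u → u < L → u < Φ u := by
    intro u hu huL
    by_contra! hcon
    exact absurd (csInf_le hbdd ⟨⟨hu, huL.le.trans hLS.1.2⟩, hcon⟩) (not_le.2 huL)
  -- `Φ L` itself satisfies `Φ (Φ L) ≤ Φ L`, so minimality of `L` gives `L ≤ Φ L`.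
  have hfix : Φ L = L := by
    refine le_antisymm hLS.2 (csInf_le hbdd ⟨⟨?_, (hmaps hL01).2⟩, ?_⟩)
    · exact hle.trans (hmono hR₀ hL01 hLS.1.1)
    · exact hmono (hmaps hL01) hL01 hLS.2
  refine ⟨L, hL01, hfix, fun κ => ?_⟩
  set u := share κ (fun _ => Φ) R₀ with hu
  have hκ1 : (0 : ℝ) < 1 / ((κ : ℝ) + 1) := by positivity
  have hκ0 : (0 : ℝ) ≤ (κ : ℝ) / (κ + 1) := by positivity
  have hsum : (κ : ℝ) / (κ + 1) + 1 / ((κ : ℝ) + 1) = 1 := by field_simp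
  have hstep : ∀ n, u (n + 1) = (κ : ℝ) / (κ + 1) * u n + 1 / ((κ : ℝ) + 1) * Φ (u n) :=
    fun n => rfl
  generalize (κ : ℝ) / (κ + 1) = ν at *
  generalize 1 / ((κ : ℝ) + 1) = ν' at *
  have hge : ∀ v ∈ Set.Icc R₀ L, v ≤ Φ v := fun v hv => by
    rcases hv.2.eq_or_lt with h | h
    · rw [h, hfix]
    · exact (hbelow v hv.1 h).le
  have hup : ∀ n, u n ∈ Set.Icc R₀ L → u n ≤ u (n + 1) := fun n hn => by
    have := mul_le_mul_of_nonneg_left (hge _ hn) hκ1.le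
    rw [hstep]
    linear_combination this - u n * hsum
  have hmem : ∀ n, u n ∈ Set.Icc R₀ L := by
    intro n
    induction n with
    | zero => exact ⟨le_rfl, hLS.1.1⟩
    | succ n ih =>
      refine ⟨ih.1.trans (hup n ih), ?_⟩
      have hΦ : Φ (u n) ≤ L :=
        (hmono ⟨hR₀.1.trans ih.1, ih.2.trans hL01.2⟩ hL01 ih.2).trans hfix.le
      rw [hstep]
      have e1 := mul_le_mul_of_nonneg_left ih.2 hκ0
      have e2 := mul_le_mul_of_nonneg_left hΦ hκ1.le
      linear_combination e1 + e2 + L * hsum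
  have hmonou : Monotone u := monotone_nat_of_le_succ fun n => hup n (hmem n)
  have hbddu : BddAbove (Set.range u) := ⟨L, by rintro _ ⟨n, rfl⟩; exact (hmem n).2⟩
  have hlim := tendsto_atTop_ciSup hmonou hbddu
  set L' := ⨆ n, u n
  have hL' : L' ∈ Set.Icc R₀ L := isClosed_Icc.mem_of_tendsto hlim (Eventually.of_forall hmem)
  have hL'01 : L' ∈ Set.Icc (0 : ℝ) 1 := ⟨hR₀.1.trans hL'.1, hL'.2.trans hL01.2⟩
  have hΦlim : Tendsto (fun n => Φ (u n)) atTop (𝓝 (Φ L')) :=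
    (hcont L' hL'01).tendsto.comp (tendsto_nhdsWithin_iff.2
      ⟨hlim, Eventually.of_forall fun n => ⟨hR₀.1.trans (hmem n).1, (hmem n).2.trans hL01.2⟩⟩)
  have hlim2 : Tendsto (fun n => u (n + 1)) atTop (𝓝 (ν * L' + ν' * Φ L')) := by
    simp_rw [hstep]
    exact (hlim.const_mul ν).add (hΦlim.const_mul ν')
  have heq := tendsto_nhds_unique hlim2 ((tendsto_add_atTop_iff_nat 1).2 hlim)
  have hfix' : Φ L' = L' := by
    have : ν' * (Φ L' - L') = 0 := by linear_combination heq - L' * hsum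
    rcases mul_eq_zero.1 this with h | h
    · exact absurd h hκ1.ne'
    · linarith
  have : L ≤ L' := csInf_le hbdd ⟨⟨hL'.1, hL'01.2⟩, hfix'.le⟩
  rwa [le_antisymm this hL'.2]

lemma exists_share_limit {Φ : ℝ → ℝ} (hmaps : Set.MapsTo Φ (Set.Icc 0 1) (Set.Icc 0 1))
    (hmono : MonotoneOn Φ (Set.Icc 0 1)) (hcont : ContinuousOn Φ (Set.Icc 0 1)) {R₀ : ℝ}
    (hR₀ : R₀ ∈ Set.Icc (0 : ℝ) 1) :
    ∃ L ∈ Set.Icc (0 : ℝ) 1, Φ L = L ∧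
      ∀ κ : ℕ, Tendsto (share κ (fun _ => Φ) R₀) atTop (𝓝 L) := by
  rcases le_total R₀ (Φ R₀) with h | h
  · exact exists_share_limit_of_le hmaps hmono hcont hR₀ h
  -- The reflection `R ↦ 1 - R` exchanges the two cases.
  have hrefl : ∀ {u : ℝ}, u ∈ Set.Icc (0 : ℝ) 1 → 1 - u ∈ Set.Icc (0 : ℝ) 1 :=
    fun hu => ⟨by linarith [hu.2], by linarith [hu.1]⟩
  obtain ⟨L, hL, hfix, hlim⟩ := exists_share_limit_of_le (Φ := fun u => 1 - Φ (1 - u))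
    (R₀ := 1 - R₀) (fun u hu => hrefl (hmaps (hrefl hu)))
    (fun u hu v hv huv => sub_le_sub_left (hmono (hrefl hv) (hrefl hu) (by linarith)) 1)
    (continuousOn_const.sub (hcont.comp (continuousOn_const.sub continuousOn_id)
      fun u hu => hrefl hu))
    (hrefl hR₀) (by simp only [sub_sub_cancel]; linarith)
  refine ⟨1 - L, hrefl hL, by linarith, fun κ => ?_⟩
  have hshare : ∀ n, share κ (fun _ => Φ) R₀ n
      = 1 - share κ (fun _ u => 1 - Φ (1 - u)) (1 - R₀) n := by
    intro n
    induction n with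
    | zero => simp [share]
    | succ n ih =>
      simp only [share]
      rw [← ih, show share κ (fun _ u => 1 - Φ (1 - u)) (1 - R₀) n
        = 1 - share κ (fun _ => Φ) R₀ n by linarith]
      field_simp
      ring
  simp_rw [funext hshare]
  exact (hlim κ).const_sub 1

lemma continuousOn_groupChoice {α v k j : ℝ} (hα : 0 ≤ α) (hk : 0 < k) (hj : 0 < j)
    (hv : v ∈ Set.Icc (0 : ℝ) 1) : ContinuousOn (groupChoice α v k j) (Set.Icc 0 1) := by
  rcases hv.1.eq_or_lt with h0 | h0
  · rw [← h0]
    exact continuousOn_const.congr fun R _ => groupChoice_zero_left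
  rcases hv.2.eq_or_lt with h1 | h1
  · rw [h1]
    exact continuousOn_const.congr fun R _ => groupChoice_one_left
  have hA : Continuous fun R : ℝ => v * (R / k) ^ α :=
    continuous_const.mul ((continuous_id.div_const k).rpow_const fun _ => Or.inr hα)
  have hB : Continuous fun R : ℝ => (1 - v) * ((1 - R) / j) ^ α :=
    continuous_const.mul
      (((continuous_const.sub continuous_id).div_const j).rpow_const fun _ => Or.inr hα)
  have heq : groupChoice α v k j = fun R =>
      v * (R / k) ^ α / (v * (R / k) ^ α + (1 - v) * ((1 - R) / j) ^ α) :=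
    funext fun R => if_neg h1.ne
  rw [heq]
  exact hA.continuousOn.div (hA.add hB).continuousOn fun R hR =>
    (groupChoice_denom_pos_of_mem_Ioo hk hj ⟨h0, h1⟩ hR).ne'

lemma continuousOn_meanGroupChoice (p μ : ℝ) {α γ : ℝ} (hγ : 0 < γ ∧ γ < 1) (hα : 0 ≤ α)
    (ω yK s : Bool) {k j : ℝ} (hk : 0 < k) (hj : 0 < j) :
    ContinuousOn (meanGroupChoice p μ α γ ω yK s k j) (Set.Icc 0 1) :=
  continuousOn_finsetSum _ fun a _ =>
    continuousOn_const.mul (continuousOn_groupChoice hα hk hj (groupValue_mem hγ s a))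

lemma exists_meanRanking_limit {p μ α γ : ℝ} (hp : 1 / 2 < p ∧ p < 1) (hμ : 1 / 2 < μ ∧ μ ≤ 1)
    (hγ : 0 < γ ∧ γ < 1) (hα : 0 ≤ α) (ω : Bool) {M : ℕ} {y : Fin M → Bool} {s : Bool}
    (hpos : 0 < (outlets y s).card) (hlt : (outlets y s).card < M) :
    ∃ x : Fin M → ℝ, theta p μ α γ ω y x = x ∧ ∀ κ : ℕ, 1 ≤ κ →
      Tendsto (meanRanking p μ α γ κ ω y (uniformRanking M)) atTop (𝓝 x) ∧
      Tendsto (fun n => meanClickProb p μ α γ κ ω y (uniformRanking M) n (outlets y s))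
        atTop (𝓝 (∑ m ∈ outlets y s, x m)) := by
  have hk : (0 : ℝ) < (outlets y s).card := by exact_mod_cast hpos
  have hj : (0 : ℝ) < (M : ℝ) - (outlets y s).card := by
    have : ((outlets y s).card : ℝ) < M := by exact_mod_cast hlt
    linarith
  set Φ := meanGroupChoice p μ α γ ω (majoritySignal y) s (outlets y s).card
    ((M : ℝ) - (outlets y s).card) with hΦ
  have hR₀ := initial_share_mem hpos hlt
  have hmaps : Set.MapsTo Φ (Set.Icc 0 1) (Set.Icc 0 1) :=
    fun R hR => meanGroupChoice_mem hp hμ hγ ω _ s hk hj hR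
  have hcont := continuousOn_meanGroupChoice p μ hγ hα ω (majoritySignal y) s hk hj
  obtain ⟨L, hL, hfix, hlim⟩ := exists_share_limit hmaps
    (fun R hR R' hR' h => meanGroupChoice_le hp hμ hγ hα ω _ s hk hj hk hj hR' hR
      (mul_le_mul_of_nonneg_right (by nlinarith) (by positivity)))
    hcont ⟨hR₀.1.le, hR₀.2.le⟩
  refine ⟨split y s L, theta_split_fixed hp hμ hγ ω hpos hlt hL hfix, fun κ hκ => ⟨?_, ?_⟩⟩
  · simp_rw [funext (meanRanking_eq_split hp hμ hγ ω hpos hlt hκ)]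
    have hc : Continuous (split y s) := by
      refine continuous_pi fun m => ?_
      unfold split
      split_ifs <;> fun_prop
    exact (hc.tendsto L).comp (hlim κ)
  · rw [sum_split hpos]
    simp_rw [meanClickProb_eq hp hμ hγ ω hpos hlt hκ]
    have h := (hcont L hL).tendsto.comp (tendsto_nhdsWithin_iff.2
      ⟨hlim κ, Eventually.of_forall fun n => by
        have := share_mem hκ hR₀ (F := fun _ => Φ) (fun _ R hR => hmaps ⟨hR.1.le, hR.2.le⟩) n
        exact ⟨this.1.le, this.2.le⟩⟩)
    rw [← hΦ, hfix] at h
    exact h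

/-! ### The law of the private signals -/

lemma measurable_clickProb {M : ℕ} (α γ : ℝ) (κ : ℕ) (y : Fin M → Bool) (r₁ : Fin M → ℝ) (n : ℕ)
    (J : Finset (Fin M)) : Measurable fun σ => clickProb α γ κ y r₁ σ n J := by
  have hv : ∀ n m, Measurable fun σ : ℕ → Bool × Bool => rankFreeValue γ y (σ n) m := fun n m =>
    (measurable_of_finite fun a => rankFreeValue γ y a m).comp (measurable_pi_apply n)
  have hc : ∀ n, (∀ m, Measurable fun σ => ranking α γ κ y r₁ σ n m) →
      ∀ m, Measurable fun σ => choice α γ y (ranking α γ κ y r₁ σ n) (σ n) m := by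
    intro n h m
    unfold choice
    exact (((h m).pow_const α).mul (hv n m)).div
      (Finset.measurable_fun_sum _ fun i _ => ((h i).pow_const α).mul (hv n i))
  have hr : ∀ n m, Measurable fun σ => ranking α γ κ y r₁ σ n m := by
    intro n
    induction n with
    | zero => exact fun m => measurable_const
    | succ n ih => exact fun m => ((ih m).const_mul _).add ((hc n ih m).const_mul _)
  exact Finset.measurable_fun_sum _ fun m _ => hc n (hr n) m

/-- A probability measure on `Bool` is determined by the probability of one point. -/
lemma map_bool_eq {Ω Ω' : Type*} [MeasurableSpace Ω] [MeasurableSpace Ω'] {P : Measure Ω}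
    {P' : Measure Ω'} [IsProbabilityMeasure P] [IsProbabilityMeasure P'] {X : Ω → Bool}
    {X' : Ω' → Bool} (hX : Measurable X) (hX' : Measurable X') {b : Bool}
    (h : P.real {w | X w = b} = P'.real {w | X' w = b}) : P.map X = P'.map X' := by
  have := Measure.isProbabilityMeasure_map (μ := P) hX.aemeasurable
  have := Measure.isProbabilityMeasure_map (μ := P') hX'.aemeasurable
  have hb : (P.map X).real {b} = (P'.map X').real {b} := by
    rw [map_measureReal_apply hX (measurableSet_singleton b),
      map_measureReal_apply hX' (measurableSet_singleton b)]
    exact h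
  refine Measure.ext_of_singleton fun c => ?_
  rw [← measureReal_eq_measureReal_iff]
  by_cases hc : c = b
  · rw [hc, hb]
  · have hcompl : ({c} : Set Bool) = {b}ᶜ := by
      ext d
      cases b <;> cases c <;> cases d <;> simp_all
    rw [hcompl, probReal_compl_eq_one_sub (measurableSet_singleton b),
      probReal_compl_eq_one_sub (measurableSet_singleton b), hb]

lemma IsSignalProcess.measurable {Ω : Type*} [MeasurableSpace Ω] {P : Measure Ω} {p μ : ℝ}
    {ω yK : Bool} {X Z : ℕ → Ω → Bool} (h : IsSignalProcess P p μ ω yK X Z) :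
    Measurable fun w i => (X i w, Z i w) :=
  measurable_pi_lambda _ fun i => (h.measurable_fst i).prodMk (h.measurable_snd i)

lemma IsSignalProcess.map_eq {Ω Ω' : Type*} [MeasurableSpace Ω] [MeasurableSpace Ω']
    {P : Measure Ω} {P' : Measure Ω'} [IsProbabilityMeasure P] [IsProbabilityMeasure P']
    {p μ : ℝ} {ω yK : Bool} {X Z : ℕ → Ω → Bool} {X' Z' : ℕ → Ω' → Bool}
    (h : IsSignalProcess P p μ ω yK X Z) (h' : IsSignalProcess P' p μ ω yK X' Z') :
    P.map (fun w i => (X i w, Z i w)) = P'.map (fun w i => (X' i w, Z' i w)) := by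
  have hm := fun i => (h.measurable_fst i).prodMk (h.measurable_snd i)
  have hm' := fun i => (h'.measurable_fst i).prodMk (h'.measurable_snd i)
  rw [(iIndepFun_iff_map_fun_eq_infinitePi_map hm).1 h.indep,
    (iIndepFun_iff_map_fun_eq_infinitePi_map hm').1 h'.indep]
  congr 1
  funext i
  rw [(indepFun_iff_map_prod_eq_prod_map_map (h.measurable_fst i).aemeasurable
      (h.measurable_snd i).aemeasurable).1 (h.indep_pair i),
    (indepFun_iff_map_prod_eq_prod_map_map (h'.measurable_fst i).aemeasurable
      (h'.measurable_snd i).aemeasurable).1 (h'.indep_pair i),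
    map_bool_eq (h.measurable_fst i) (h'.measurable_fst i)
      ((h.prob_fst i).trans (h'.prob_fst i).symm),
    map_bool_eq (h.measurable_snd i) (h'.measurable_snd i)
      ((h.prob_snd i).trans (h'.prob_snd i).symm)]

lemma integrable_clickProb {M : ℕ} {y : Fin M → Bool} {s : Bool} (α : ℝ) {γ : ℝ}
    (hγ : 0 < γ ∧ γ < 1) (hpos : 0 < (outlets y s).card) (hlt : (outlets y s).card < M) {κ : ℕ}
    (hκ : 1 ≤ κ) (Q : Measure (ℕ → Bool × Bool)) [IsFiniteMeasure Q] (n : ℕ) :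
    Integrable (fun σ => clickProb α γ κ y (uniformRanking M) σ n (outlets y s)) Q := by
  refine Integrable.of_bound (measurable_clickProb α γ κ y _ n _).aestronglyMeasurable 1
    (Eventually.of_forall fun σ => ?_)
  have hF := fun (i : ℕ) (R : ℝ) (hR : R ∈ Set.Ioo (0 : ℝ) 1) =>
    groupChoice_outlets_mem α hγ hpos hlt (σ i) hR
  rw [clickProb_eq hγ hpos hlt hκ, Real.norm_eq_abs, abs_le]
  have := hF n _ (share_mem hκ (initial_share_mem hpos hlt) hF n)
  exact ⟨by linarith [this.1], this.2⟩

/-- The majority carries `s` exactly when more than half of the outlets do; oddness excludes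
ties. -/
lemma majoritySignal_eq {M : ℕ} (hM : Odd M) (y : Fin M → Bool) (s : Bool) :
    majoritySignal y = if M < 2 * (outlets y s).card then s else !s := by
  have h := card_outlets_add y s
  obtain ⟨t, ht⟩ := hM
  unfold majoritySignal
  cases s
  · simp only [Bool.not_false] at h
    by_cases h1 : M < 2 * (outlets y true).card
    · rw [if_neg (by omega)]
      simp [h1]
    · rw [if_pos (by omega)]
      simp [h1]
  · by_cases h1 : M < 2 * (outlets y true).card <;> simp [h1]

/-! ### The comparison of two realizations -/

section Comparison

variable {M : ℕ} {p μ γ α : ℝ} {s : Bool} {y y' : Fin M → Bool}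

lemma clickProb_le (hγ : 0 < γ ∧ γ < 1) (hα : 0 ≤ α) (hpos : 0 < (outlets y s).card)
    (hle : (outlets y s).card ≤ (outlets y' s).card) (hlt : (outlets y' s).card < M)
    {κ : ℕ} (hκ : 1 ≤ κ) (σ : ℕ → Bool × Bool) (n : ℕ) :
    clickProb α γ κ y' (uniformRanking M) σ n (outlets y' s)
      ≤ clickProb α γ κ y (uniformRanking M) σ n (outlets y s) := by
  have hk : (0 : ℝ) < (outlets y s).card := by exact_mod_cast hpos
  have hkk : ((outlets y s).card : ℝ) ≤ (outlets y' s).card := by exact_mod_cast hle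
  have hN : ((outlets y' s).card : ℝ) < M := by exact_mod_cast hlt
  rw [clickProb_eq hγ (hpos.trans_le hle) hlt hκ, clickProb_eq hγ hpos (hle.trans_lt hlt) hκ]
  refine share_le hκ hk hkk hN
    (fun i R hR => groupChoice_outlets_mem α hγ hpos (hle.trans_lt hlt) (σ i) hR)
    (fun i R hR => groupChoice_outlets_mem α hγ (hpos.trans_le hle) hlt (σ i) hR)
    (fun i R hR R' hR' h => ?_) n
  exact groupChoice_le hα hk (by linarith) (by linarith) (by linarith)
    (groupValue_mem hγ s (σ i)) ⟨hR.1.le, hR.2.le⟩ ⟨hR'.1.le, hR'.2.le⟩ h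

lemma meanClickProb_le (hp : 1 / 2 < p ∧ p < 1) (hμ : 1 / 2 < μ ∧ μ ≤ 1) (hγ : 0 < γ ∧ γ < 1)
    (hα : 0 ≤ α) (ω : Bool) (hmaj : majoritySignal y' = majoritySignal y)
    (hpos : 0 < (outlets y s).card) (hle : (outlets y s).card ≤ (outlets y' s).card)
    (hlt : (outlets y' s).card < M) {κ : ℕ} (hκ : 1 ≤ κ) (n : ℕ) :
    meanClickProb p μ α γ κ ω y' (uniformRanking M) n (outlets y' s)
      ≤ meanClickProb p μ α γ κ ω y (uniformRanking M) n (outlets y s) := by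
  have hk : (0 : ℝ) < (outlets y s).card := by exact_mod_cast hpos
  have hkk : ((outlets y s).card : ℝ) ≤ (outlets y' s).card := by exact_mod_cast hle
  have hN : ((outlets y' s).card : ℝ) < M := by exact_mod_cast hlt
  rw [meanClickProb_eq hp hμ hγ ω (hpos.trans_le hle) hlt hκ,
    meanClickProb_eq hp hμ hγ ω hpos (hle.trans_lt hlt) hκ, hmaj]
  refine share_le hκ hk hkk hN
    (F := fun _ => meanGroupChoice p μ α γ ω (majoritySignal y) s (outlets y s).card
      ((M : ℝ) - (outlets y s).card))
    (F' := fun _ => meanGroupChoice p μ α γ ω (majoritySignal y) s (outlets y' s).card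
      ((M : ℝ) - (outlets y' s).card))
    (fun _ R hR => meanGroupChoice_outlets_mem α hp hμ hγ ω _ hpos (hle.trans_lt hlt) hR)
    (fun _ R hR => meanGroupChoice_outlets_mem α hp hμ hγ ω _ (hpos.trans_le hle) hlt hR)
    (fun _ R hR R' hR' h => ?_) n
  exact meanGroupChoice_le hp hμ hγ hα ω _ s hk (by linarith) (by linarith) (by linarith)
    ⟨hR.1.le, hR.2.le⟩ ⟨hR'.1.le, hR'.2.le⟩ h

end Comparison

end SearchModel

/-- Advantage of the fewer. `y` and `y'` are two realizations of the signals of the outlets, and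
`J = outlets y s`, `J' = outlets y' s` are the sets of outlets carrying the fixed signal `s`.
The hypotheses on the numbers `#J ≤ #J'` say that no step from `k` to `k + 1` outlets with
`k = 0`, `(M - 1) / 2` or `M - 1` is crossed between them. The claims are: every realization of
the private signals; the expectation over the private signals; the mean dynamics and its limit,
a fixed point of `θ`. -/
theorem proposition1 (M : ℕ) (hM : Odd M) (p μ γ α : ℝ)
    (hp : 1 / 2 < p ∧ p < 1) (hμ : 1 / 2 < μ ∧ μ ≤ 1) (hγ : 0 < γ ∧ γ < 1) (hα : 0 ≤ α)
    (ω s : Bool) (y y' : Fin M → Bool)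
    (hpos : 0 < (SearchModel.outlets y s).card)
    (hle : (SearchModel.outlets y s).card ≤ (SearchModel.outlets y' s).card)
    (hlt : (SearchModel.outlets y' s).card < M)
    (hside : (SearchModel.outlets y s).card ≤ (M - 1) / 2 →
      (SearchModel.outlets y' s).card ≤ (M - 1) / 2) :
    (∀ (κ : ℕ), 1 ≤ κ → ∀ (σ : ℕ → Bool × Bool) (n : ℕ),
      SearchModel.clickProb α γ κ y' (SearchModel.uniformRanking M) σ n
          (SearchModel.outlets y' s) ≤
        SearchModel.clickProb α γ κ y (SearchModel.uniformRanking M) σ n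
          (SearchModel.outlets y s)) ∧
    (∀ (κ : ℕ), 1 ≤ κ → ∀ {Ω Ω' : Type*} [MeasurableSpace Ω] [MeasurableSpace Ω']
      (P : Measure Ω) (P' : Measure Ω') [IsProbabilityMeasure P] [IsProbabilityMeasure P']
      (X Z : ℕ → Ω → Bool) (X' Z' : ℕ → Ω' → Bool),
      SearchModel.IsSignalProcess P p μ ω (SearchModel.majoritySignal y) X Z →
      SearchModel.IsSignalProcess P' p μ ω (SearchModel.majoritySignal y') X' Z' →
      ∀ n : ℕ,
        Integrable (fun w => SearchModel.clickProb α γ κ y (SearchModel.uniformRanking M)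
          (fun i => (X i w, Z i w)) n (SearchModel.outlets y s)) P ∧
        Integrable (fun w => SearchModel.clickProb α γ κ y' (SearchModel.uniformRanking M)
          (fun i => (X' i w, Z' i w)) n (SearchModel.outlets y' s)) P' ∧
        ∫ w, SearchModel.clickProb α γ κ y' (SearchModel.uniformRanking M)
            (fun i => (X' i w, Z' i w)) n (SearchModel.outlets y' s) ∂P' ≤
          ∫ w, SearchModel.clickProb α γ κ y (SearchModel.uniformRanking M)
            (fun i => (X i w, Z i w)) n (SearchModel.outlets y s) ∂P) ∧
    (∀ (κ : ℕ), 1 ≤ κ → ∀ n : ℕ,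
      SearchModel.meanClickProb p μ α γ κ ω y' (SearchModel.uniformRanking M) n
          (SearchModel.outlets y' s) ≤
        SearchModel.meanClickProb p μ α γ κ ω y (SearchModel.uniformRanking M) n
          (SearchModel.outlets y s)) ∧
    (∃ x x' : Fin M → ℝ,
      SearchModel.theta p μ α γ ω y x = x ∧ SearchModel.theta p μ α γ ω y' x' = x' ∧
      (∀ (κ : ℕ), 1 ≤ κ →
        Tendsto (SearchModel.meanRanking p μ α γ κ ω y (SearchModel.uniformRanking M))
          atTop (𝓝 x) ∧
        Tendsto (SearchModel.meanRanking p μ α γ κ ω y' (SearchModel.uniformRanking M))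
          atTop (𝓝 x') ∧
        Tendsto (fun n => SearchModel.meanClickProb p μ α γ κ ω y
          (SearchModel.uniformRanking M) n (SearchModel.outlets y s))
          atTop (𝓝 (∑ m ∈ SearchModel.outlets y s, x m)) ∧
        Tendsto (fun n => SearchModel.meanClickProb p μ α γ κ ω y'
          (SearchModel.uniformRanking M) n (SearchModel.outlets y' s))
          atTop (𝓝 (∑ m ∈ SearchModel.outlets y' s, x' m))) ∧
      ∑ m ∈ SearchModel.outlets y' s, x' m ≤ ∑ m ∈ SearchModel.outlets y s, x m) := by
  have hpos' := hpos.trans_le hle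
  have hlt₀ := hle.trans_lt hlt
  have hmaj : SearchModel.majoritySignal y' = SearchModel.majoritySignal y := by
    rw [SearchModel.majoritySignal_eq hM y' s, SearchModel.majoritySignal_eq hM y s]
    obtain ⟨t, ht⟩ := hM
    by_cases h : M < 2 * (SearchModel.outlets y s).card
    · rw [if_pos h, if_pos (by omega)]
    · have := hside (by omega)
      rw [if_neg h, if_neg (by omega)]
  have h₁ := fun (κ : ℕ) (hκ : 1 ≤ κ) (σ : ℕ → Bool × Bool) (n : ℕ) =>
    SearchModel.clickProb_le hγ hα hpos hle hlt hκ σ n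
  have h₃ := fun (κ : ℕ) (hκ : 1 ≤ κ) (n : ℕ) =>
    SearchModel.meanClickProb_le hp hμ hγ hα ω hmaj hpos hle hlt hκ n
  refine ⟨h₁, ?_, h₃, ?_⟩
  · intro κ hκ Ω Ω' _ _ P P' _ _ X Z X' Z' hS hS' n
    rw [hmaj] at hS'
    have hm := hS.measurable
    have hm' := hS'.measurable
    have := Measure.isProbabilityMeasure_map (μ := P) hm.aemeasurable
    have := Measure.isProbabilityMeasure_map (μ := P') hm'.aemeasurable
    have hi := SearchModel.integrable_clickProb α hγ hpos hlt₀ hκ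
      (P.map fun w i => (X i w, Z i w)) n
    have hi' := SearchModel.integrable_clickProb α hγ hpos' hlt hκ
      (P'.map fun w i => (X' i w, Z' i w)) n
    refine ⟨hi.comp_measurable hm, hi'.comp_measurable hm', ?_⟩
    -- Both expectations are integrals over the common law of the sequences of signals.
    rw [← integral_map (φ := fun w i => (X' i w, Z' i w)) hm'.aemeasurable
        hi'.aestronglyMeasurable,
      ← integral_map (φ := fun w i => (X i w, Z i w)) hm.aemeasurable hi.aestronglyMeasurable,
      hS.map_eq hS']
    rw [hS.map_eq hS'] at hi
    exact integral_mono hi' hi fun σ => h₁ κ hκ σ n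
  · obtain ⟨x, hx, hlim⟩ := SearchModel.exists_meanRanking_limit hp hμ hγ hα ω hpos hlt₀
    obtain ⟨x', hx', hlim'⟩ := SearchModel.exists_meanRanking_limit hp hμ hγ hα ω hpos' hlt
    exact ⟨x, x', hx, hx', fun κ hκ => ⟨(hlim κ hκ).1, (hlim' κ hκ).1, (hlim κ hκ).2,
      (hlim' κ hκ).2⟩, le_of_tendsto_of_tendsto' (hlim' 1 le_rfl).2 (hlim 1 le_rfl).2
      (h₃ 1 le_rfl)⟩
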